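/- For a permutation $\tau=\tau_1\tau_2\cdots\tau_n$ of $\{1,\dots,n\}$ let $\mathrm{asc}(\tau)=|\{1\le j\le n-1:\tau_j<\tau_{j+1}\}|$ be its number of ascents. For integers $n,i\ge1$ let $C'(n,i)$ be the number of cyclic permutations $\tau$ of $\{1,\dots,n\}$ (those consisting of a single cycle of length $n$) with $\mathrm{asc}(\tau)=i-1$; thus $C'(n,i)=0$ for $i>n$. Let $$L_k(n)=\frac1n\sum_{d\mid n}\mu(d)\,k^{n/d},$$ where $\mu$ is the Möbius function. **Theorem.** Let $n\ge3$ with $n\equiv2\pmod 4$ and let $k\ge3$. Then $$L_k(n)=\sum_{i=2}^{k}\left[\binom{n+k-i}{k-i}C'(n,i)-\binom{\frac n2+k-i}{k-i}C'\!\left(\tfrac n2,i\right)\right].$$ Consequently, $$C'(n,k)=L_k(n)-\sum_{i=2}^{k-1}\left[\binom{n+k-i}{k-i}C'(n,i)-\binom{\frac n2+k-i}{k-i}C'\!\left(\tfrac n2,i\right)\right]+C'\!\left(\tfrac n2,k\right).$$ -/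

import Mathlib

namespace CyclicAscents

/-- The ascent set of a permutation `τ` of `{0, …, n-1}`: the positions `i`, other than the last
one, with `τ(i) < τ(i+1)`. -/
def ascSet {n : ℕ} (τ : Equiv.Perm (Fin n)) : Finset (Fin n) :=
  Finset.univ.filter fun i : Fin n => ∃ h : (i : ℕ) + 1 < n, τ i < τ ⟨(i : ℕ) + 1, h⟩

/-- The number of ascents of `τ`. -/
def asc {n : ℕ} (τ : Equiv.Perm (Fin n)) : ℕ := (ascSet τ).card

/-- The set of cyclic permutations of `{0, …, n-1}`, i.e. those consisting of one cycle
of length `n`. -/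
def cyclicPerms (n : ℕ) : Set (Equiv.Perm (Fin n)) :=
  {τ | τ.IsCycleOn Set.univ}

/-- `C'(n, i)`: the number of cyclic permutations of `{0, …, n-1}` with exactly `i - 1` ascents
(this is `0` for `i = 0` and for `i > n`, when `n ≥ 1`). -/
noncomputable def C' (n i : ℕ) : ℕ :=
  {τ : Equiv.Perm (Fin n) | τ ∈ cyclicPerms n ∧ asc τ + 1 = i}.ncard

/-- `L_k(n) = (1/n) ∑_{d ∣ n} μ(d) k^{n/d}`, with `μ` the Möbius function. -/
def L (k n : ℕ) : ℚ :=
  (1 / (n : ℚ)) * ∑ d ∈ n.divisors, (ArithmeticFunction.moebius d : ℚ) * (k : ℚ) ^ (n / d)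

end CyclicAscents

/-!
The sum `∑ i, (n + k - i).choose (k - i) * C' n i` counts pairs `(τ, s)` of a cyclic permutation `τ`
of the `n` positions and a weakly increasing labelling `s` of them by `k` letters such that `τ`
decreases on positions with equal labels: such an `s` must increase strictly at the ascents of `τ`,
and after adding to `s i` the number of earlier non-ascents it is just a strictly increasing
sequence (`card_labelledCycle`).

Reading the labels along the cycle of `τ` from a chosen position gives an `n`-periodic word `w`,
and reading the positions gives a ranking of its starting points: smaller first letters rank lower,
and among equal first letters the order is the reverse of that of the next starting points. This is
a bijection (`card_labelledCycle_mul`), so it remains to count the rankings of each word.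

A ranking must refine the alternating lexicographic order on suffixes, so a primitive word has
exactly one ranking (`existsUnique_isRanking`). For a word of smaller minimal period `p`, ties
have to be broken; translation by an even period preserves the order of tied ranks, which is
impossible on a finite cycle unless that period is a multiple of `n`. Hence `p` is odd and `n = 2 p`
(`IsRanking.minimalPeriod_cases`), and then the ties can be broken by parity in exactly two ways
(`ncard_isRanking_eq_two`).

Möbius inversion shows that `L k n` is the number of primitive words of length `n` divided by `n`
(`L_eq_primCount_div`). So for odd `m` the sum above is `L k m` for `n = m`, and
`L k (2 * m) + L k m` for `n = 2 * m`. The difference of the two is the recurrence; its terms `i = 1`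
vanish, because over a one-letter alphabet there are no primitive words of length greater than one.
-/

namespace CyclicAscents

open Function Equiv

/-! ### Periodic and primitive words -/

/-- The shift on infinite words. Words of length `n` are encoded as the `n`-periodic infinite
words, so that words of all lengths live in the same type. -/
def shift {α : Type*} (w : ℕ → α) : ℕ → α := fun i => w (i + 1)

lemma shift_iterate_apply {α : Type*} (w : ℕ → α) (m i : ℕ) : shift^[m] w i = w (i + m) := by
  induction m generalizing w with
  | zero => rfl
  | succ m ih =>
    rw [iterate_succ_apply, ih]
    exact congrArg w (by omega)

lemma isPeriodicPt_shift_iff {α : Type*} {w : ℕ → α} {n : ℕ} :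
    IsPeriodicPt shift n w ↔ Periodic w n := by
  simp only [IsPeriodicPt, IsFixedPt, funext_iff, shift_iterate_apply, Periodic]

lemma minimalPeriod_shift_dvd_iff {α : Type*} {w : ℕ → α} {n : ℕ} :
    minimalPeriod shift w ∣ n ↔ Periodic w n := by
  rw [← isPeriodicPt_shift_iff, isPeriodicPt_iff_minimalPeriod_dvd]

/-- Two suffixes of a periodic word agree exactly when their starting points are congruent modulo
the minimal period. -/
lemma suffix_eq_iff {α : Type*} {w : ℕ → α} (hw : 0 < minimalPeriod shift w) {i j : ℕ} :
    (∀ t, w (i + t) = w (j + t)) ↔ i ≡ j [MOD minimalPeriod shift w] := by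
  rw [Nat.ModEq, ← iterate_eq_iterate_iff_of_lt_minimalPeriod (Nat.mod_lt i hw) (Nat.mod_lt j hw),
    iterate_mod_minimalPeriod_eq, iterate_mod_minimalPeriod_eq, funext_iff]
  simp only [shift_iterate_apply, add_comm]

/-- An `n`-periodic word is determined by its first `n` letters. -/
def periodicEquiv (α : Type*) {n : ℕ} (hn : 0 < n) :
    {w : ℕ → α // Periodic w n} ≃ (Fin n → α) where
  toFun w i := w.1 i
  invFun v := ⟨fun i => v ⟨i % n, Nat.mod_lt i hn⟩, fun i => by simp⟩
  left_inv w := Subtype.ext (funext fun i => w.2.map_mod_nat i)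
  right_inv v := funext fun i => congrArg v (Fin.ext (Nat.mod_eq_of_lt i.2))

lemma card_periodic (k : ℕ) {n : ℕ} (hn : 0 < n) :
    Nat.card {w : ℕ → Fin k // Periodic w n} = k ^ n := by
  rw [Nat.card_congr (periodicEquiv (Fin k) hn)]
  simp

lemma finite_periodic (k : ℕ) {n : ℕ} (hn : 0 < n) : {w : ℕ → Fin k | Periodic w n}.Finite :=
  Set.finite_coe_iff.1 ((periodicEquiv (Fin k) hn).finite_iff.2 inferInstance)

/-- The finite set of words of period `n` over an alphabet of `k` letters. -/
noncomputable def periodicWords (k n : ℕ) : Finset (ℕ → Fin k) :=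
  if hn : 0 < n then (finite_periodic k hn).toFinset else ∅

lemma mem_periodicWords {k n : ℕ} (hn : 0 < n) {w : ℕ → Fin k} :
    w ∈ periodicWords k n ↔ minimalPeriod shift w ∣ n := by
  simp [periodicWords, hn, minimalPeriod_shift_dvd_iff]

lemma card_periodicWords (k : ℕ) {n : ℕ} (hn : 0 < n) : (periodicWords k n).card = k ^ n := by
  rw [← card_periodic k hn, periodicWords, dif_pos hn, ← Set.ncard_eq_toFinset_card _ _]
  rfl

/-- The number of primitive words of length `n` over an alphabet of `k` letters. -/
noncomputable def primCount (k n : ℕ) : ℕ :=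
  ((periodicWords k n).filter fun w => minimalPeriod shift w = n).card

lemma filter_minimalPeriod_eq {k n d : ℕ} (hn : 0 < n) (hd : d ∣ n) :
    ((periodicWords k n).filter fun w => minimalPeriod shift w = d) =
      (periodicWords k d).filter fun w => minimalPeriod shift w = d := by
  ext w
  simp only [Finset.mem_filter, mem_periodicWords hn,
    mem_periodicWords (Nat.pos_of_dvd_of_pos hd hn)]
  constructor
  · rintro ⟨-, rfl⟩
    exact ⟨dvd_rfl, rfl⟩
  · rintro ⟨-, rfl⟩
    exact ⟨hd, rfl⟩

lemma sum_divisors_primCount (k : ℕ) {n : ℕ} (hn : 0 < n) :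
    ∑ d ∈ n.divisors, primCount k d = k ^ n := by
  rw [← card_periodicWords k hn, Finset.card_eq_sum_card_fiberwise
    (f := fun w => minimalPeriod shift w) (t := n.divisors)]
  · refine Finset.sum_congr rfl fun d hd => ?_
    rw [filter_minimalPeriod_eq hn (Nat.dvd_of_mem_divisors hd), primCount]
  · intro w hw
    simpa using ⟨(mem_periodicWords hn).1 hw, hn.ne'⟩

lemma L_eq_primCount_div (k : ℕ) {n : ℕ} (hn : 0 < n) : L k n = primCount k n / n := by
  have h := (ArithmeticFunction.sum_eq_iff_sum_mul_moebius_eq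
    (f := fun d => (primCount k d : ℚ)) (g := fun d => (k : ℚ) ^ d)).1
    (fun n hn => by exact_mod_cast sum_divisors_primCount k hn) n hn
  rw [Nat.sum_divisorsAntidiagonal
    (fun d e => ((ArithmeticFunction.moebius d : ℤ) : ℚ) * (k : ℚ) ^ e)] at h
  rw [L, h]
  ring

/-- Over a single letter only the word of length one is primitive. -/
lemma primCount_one_eq_zero {n : ℕ} (hn : 1 < n) : primCount 1 n = 0 := by
  rw [primCount, Finset.card_eq_zero, Finset.filter_eq_empty_iff]
  intro w _
  rw [minimalPeriod_eq_one_of_subsingleton]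
  omega

/-! ### Rankings of the suffixes of a word -/

/-- A ranking of a word `w` assigns to each starting point `i` a rank `r i : Fin n`, in such a way
that exactly the starting points congruent modulo `n` share a rank, a smaller first letter gives a
smaller rank, and for equal first letters the order is the reverse of the order of the next
starting points. -/
structure IsRanking {n k : ℕ} (w : ℕ → Fin k) (r : ℕ → Fin n) : Prop where
  eq_iff : ∀ i j, r i = r j ↔ i ≡ j [MOD n]
  lt_of_lt : ∀ i j, w i < w j → r i < r j
  succ_lt : ∀ i j, w i = w j → r i < r j → r (j + 1) < r (i + 1)

lemma surjective_of_eq_iff {n : ℕ} {r : ℕ → Fin n} (h : ∀ i j, r i = r j ↔ i ≡ j [MOD n]) :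
    Surjective r := by
  have hinj : Injective fun i : Fin n => r i := fun i j hij =>
    Fin.ext (Nat.ModEq.eq_of_lt_of_lt ((h _ _).1 hij) i.2 j.2)
  intro a
  obtain ⟨i, hi⟩ := (Finite.injective_iff_surjective.1 hinj) a
  exact ⟨i, hi⟩

/-- A function into `Fin n` with prescribed fibres is determined by the order it induces. -/
lemma eq_of_lt_imp_lt {n : ℕ} {r r' : ℕ → Fin n} (hr : ∀ i j, r i = r j ↔ i ≡ j [MOD n])
    (hr' : ∀ i j, r' i = r' j ↔ i ≡ j [MOD n]) (h : ∀ i j, r' i < r' j → r i < r j) : r = r' := by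
  obtain ⟨g, hg⟩ := (surjective_of_eq_iff hr').hasRightInverse
  have key : ∀ i, r (g (r' i)) = r i := fun i => (hr _ _).2 ((hr' _ _).1 (hg _))
  have hmono : StrictMono fun a => r (g a) := fun a b hab => h _ _ (by rwa [hg, hg])
  have hsurj : Surjective fun a => r (g a) := fun a => by
    obtain ⟨i, rfl⟩ := surjective_of_eq_iff hr a
    exact ⟨r' i, key i⟩
  have hid : (fun a => r (g a)) = id :=
    (StrictMono.range_inj hmono strictMono_id).1 (by rw [hsurj.range_eq, Set.range_id])
  funext i
  rw [← key i]
  exact congrFun hid (r' i)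

/-- Keys in a linear order that repeat with period exactly `n` can be replaced by ranks. -/
lemma exists_rank {α : Type*} [LinearOrder α] {n : ℕ} (hn : 0 < n) {key : ℕ → α}
    (h : ∀ i j, key i = key j ↔ i ≡ j [MOD n]) :
    ∃ r : ℕ → Fin n, ∀ i j, r i < r j ↔ key i < key j := by
  have hcard : ((Finset.range n).image key).card = n := by
    rw [Finset.card_image_of_injOn, Finset.card_range]
    intro i hi j hj hij
    exact Nat.ModEq.eq_of_lt_of_lt ((h _ _).1 hij) (by simpa using hi) (by simpa using hj)
  have hmem : ∀ i, key i ∈ (Finset.range n).image key := fun i =>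
    Finset.mem_image.2 ⟨i % n, Finset.mem_range.2 (Nat.mod_lt i hn),
      (h _ _).2 (Nat.mod_modEq i n)⟩
  refine ⟨fun i => (Finset.orderIsoOfFin _ hcard).symm ⟨key i, hmem i⟩, fun i j => ?_⟩
  rw [OrderIso.lt_iff_lt, Subtype.mk_lt_mk]

namespace IsRanking

variable {n k : ℕ} {w : ℕ → Fin k} {r : ℕ → Fin n}

lemma periodic (h : IsRanking w r) : Periodic w n := fun i => by
  have hr : r (i + n) = r i := (h.eq_iff _ _).2 (by simp [Nat.ModEq])
  rcases lt_trichotomy (w (i + n)) (w i) with hlt | heq | hlt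
  · exact absurd hr (h.lt_of_lt _ _ hlt).ne
  · exact heq
  · exact absurd hr (h.lt_of_lt _ _ hlt).ne'

/-- Along equal suffixes, the order of the ranks flips at every step. -/
lemma lt_add (h : IsRanking w r) {i j : ℕ} (hw : ∀ t, w (i + t) = w (j + t)) (hij : r i < r j)
    (t : ℕ) : (Even t → r (i + t) < r (j + t)) ∧ (¬ Even t → r (j + t) < r (i + t)) := by
  induction t with
  | zero => simpa using hij
  | succ t ih =>
    rw [Nat.even_add_one, not_not]
    exact ⟨fun ht => h.succ_lt _ _ (hw t).symm (ih.2 ht), fun ht => h.succ_lt _ _ (hw t) (ih.1 ht)⟩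

/-- The first difference of two suffixes decides the order of their ranks, by the parity of
its position. -/
lemma lt_of_first_difference (h : IsRanking w r) {m i j : ℕ}
    (heq : ∀ t < m, w (i + t) = w (j + t))
    (hlt : if Even m then w (i + m) < w (j + m) else w (j + m) < w (i + m)) : r i < r j := by
  induction m generalizing i j with
  | zero => exact h.lt_of_lt _ _ (by simpa using hlt)
  | succ m ih =>
    have hsucc : r (j + 1) < r (i + 1) := by
      refine ih (fun t ht => ?_) ?_
      · have := heq (t + 1) (by omega)
        rw [add_right_comm, add_right_comm i]
        exact this.symm
      · rw [add_right_comm, add_right_comm i]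
        by_cases hm : Even m <;> simpa [Nat.even_add_one, hm, add_assoc] using hlt
    rcases lt_trichotomy (r i) (r j) with hlt' | heq' | hlt'
    · exact hlt'
    · exact absurd ((h.eq_iff _ _).2 (((h.eq_iff _ _).1 heq').add_right 1)) hsucc.ne'
    · exact absurd (h.succ_lt _ _ (heq 0 m.succ_pos).symm hlt') hsucc.not_gt

/-- An even period of a ranked word is a multiple of `n`: translation by it preserves the order of
ranks of equal suffixes, so it cannot move a rank without moving it forever in one direction. -/
lemma dvd_of_even_period (h : IsRanking w r) {q : ℕ} (hq : Even q) (hw : Periodic w q) :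
    n ∣ q := by
  have hper : ∀ m i, w (i + m * q) = w i := fun m i => by
    simpa using hw.nat_mul m i
  have hadd : ∀ m, (r 0 < r q → r (m * q) < r (m * q + q)) ∧
      (r q < r 0 → r (m * q + q) < r (m * q)) := fun m => by
    have hwq : ∀ t, w (0 + t) = w (q + t) := fun t => by
      rw [zero_add, add_comm q t, hw]
    have he : Even (m * q) := hq.mul_left m
    refine ⟨fun hlt => ?_, fun hlt => ?_⟩
    · simpa [add_comm] using (h.lt_add hwq hlt (m * q)).1 he
    · simpa [add_comm] using (h.lt_add (fun t => (hwq t).symm) hlt (m * q)).1 he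
  have hn : 0 < n := (r 0).pos
  have hcyc : r (n * q) = r 0 := (h.eq_iff _ _).2 (by simp [Nat.ModEq])
  have hs : ∀ m, (m + 1) * q = m * q + q := fun m => by ring
  rcases lt_trichotomy (r 0) (r q) with hlt | heq | hlt
  · have hmono : StrictMono fun m => r (m * q) :=
      strictMono_nat_of_lt_succ fun m => by simpa only [hs] using (hadd m).1 hlt
    have := hmono hn
    simp [hcyc] at this
  · exact (Nat.modEq_zero_iff_dvd).1 ((h.eq_iff _ _).1 heq.symm)
  · have hanti : StrictAnti fun m => r (m * q) :=
      strictAnti_nat_of_succ_lt fun m => by simpa only [hs] using (hadd m).2 hlt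
    have := hanti hn
    simp [hcyc] at this

/-- Besides primitive words of length `n`, only squares of primitive words of odd length have a
ranking. -/
lemma minimalPeriod_cases (h : IsRanking w r) :
    minimalPeriod shift w = n ∨
      (Odd (minimalPeriod shift w) ∧ n = 2 * minimalPeriod shift w) := by
  have hdvd : minimalPeriod shift w ∣ n := minimalPeriod_shift_dvd_iff.2 h.periodic
  rcases Nat.even_or_odd (minimalPeriod shift w) with he | ho
  · exact Or.inl (Nat.dvd_antisymm hdvd
      (h.dvd_of_even_period he (minimalPeriod_shift_dvd_iff.1 dvd_rfl)))
  · have hn2 : n ∣ 2 * minimalPeriod shift w :=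
      h.dvd_of_even_period (even_two_mul _) (minimalPeriod_shift_dvd_iff.1 (Dvd.intro_left 2 rfl))
    obtain ⟨c, hc⟩ := hdvd
    have hpos : 0 < minimalPeriod shift w := ho.pos
    have hc2 : c ∣ 2 := by
      rw [hc, mul_comm 2] at hn2
      exact Nat.dvd_of_mul_dvd_mul_left hpos hn2
    rcases (Nat.dvd_prime Nat.prime_two).1 hc2 with rfl | rfl
    · left; omega
    · right; exact ⟨ho, by omega⟩

end IsRanking

/-! ### The alternating lexicographic order -/

/-- The suffix of `w` starting at `i`, with the letters at odd places reversed: comparing these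
lexicographically is the alternating lexicographic order on suffixes. -/
def altKey {k : ℕ} (w : ℕ → Fin k) (i : ℕ) : Lex (ℕ → Fin k) :=
  toLex fun t => if Even t then w (i + t) else (w (i + t)).rev

section altKey

variable {k : ℕ} {w : ℕ → Fin k} {i j : ℕ}

lemma altKey_eq_iff : altKey w i = altKey w j ↔ ∀ t, w (i + t) = w (j + t) := by
  rw [altKey, altKey, toLex_inj, funext_iff]
  refine forall_congr' fun t => ?_
  split_ifs <;> simp

lemma altKey_lt_iff : altKey w i < altKey w j ↔ ∃ m, (∀ t < m, w (i + t) = w (j + t)) ∧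
    if Even m then w (i + m) < w (j + m) else w (j + m) < w (i + m) := by
  refine exists_congr fun m => and_congr (forall₂_congr fun t _ => ?_) ?_
  · simp only [altKey, Pi.toLex_apply]
    split_ifs <;> simp
  · simp only [altKey, Pi.toLex_apply]
    split_ifs <;> simp

lemma altKey_lt_of_lt (h : w i < w j) : altKey w i < altKey w j :=
  altKey_lt_iff.2 ⟨0, by simp, by simpa using h⟩

lemma altKey_succ_lt (h : w i = w j) (hlt : altKey w i < altKey w j) :
    altKey w (j + 1) < altKey w (i + 1) := by
  obtain ⟨m, heq, hm⟩ := altKey_lt_iff.1 hlt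
  cases m with
  | zero => simp [h] at hm
  | succ m =>
    refine altKey_lt_iff.2 ⟨m, fun t ht => ?_, ?_⟩
    · rw [add_right_comm, add_right_comm i]
      exact (heq (t + 1) (by omega)).symm
    · rw [add_right_comm, add_right_comm i]
      by_cases he : Even m <;> simpa [Nat.even_add_one, he, add_assoc] using hm

lemma altKey_succ_eq (h : altKey w i = altKey w j) : altKey w (i + 1) = altKey w (j + 1) :=
  altKey_eq_iff.2 fun t => by
    simpa [add_assoc, add_comm 1 t] using altKey_eq_iff.1 h (t + 1)

lemma IsRanking.lt_of_altKey_lt {n : ℕ} {r : ℕ → Fin n} (h : IsRanking w r)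
    (hlt : altKey w i < altKey w j) : r i < r j := by
  obtain ⟨m, heq, hm⟩ := altKey_lt_iff.1 hlt
  exact h.lt_of_first_difference heq hm

end altKey

lemma eq_iff_of_lt_iff {α : Type*} [LinearOrder α] {n : ℕ} {r : ℕ → Fin n} {key : ℕ → α}
    (h : ∀ i j, r i < r j ↔ key i < key j) (i j : ℕ) : r i = r j ↔ key i = key j := by
  rw [← not_iff_not, ← ne_eq, ← ne_eq, ← lt_or_lt_iff_ne, ← lt_or_lt_iff_ne, h, h]

/-- A primitive word has exactly one ranking. -/
lemma existsUnique_isRanking {n k : ℕ} (hn : 0 < n) {w : ℕ → Fin k}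
    (hw : minimalPeriod shift w = n) : ∃! r : ℕ → Fin n, IsRanking w r := by
  have hkey : ∀ i j, altKey w i = altKey w j ↔ i ≡ j [MOD n] := fun i j => by
    rw [altKey_eq_iff, suffix_eq_iff (hw ▸ hn), hw]
  obtain ⟨r, hr⟩ := exists_rank hn hkey
  have hrank : IsRanking w r :=
    { eq_iff := fun i j => (eq_iff_of_lt_iff hr i j).trans (hkey i j)
      lt_of_lt := fun i j hij => (hr i j).2 (altKey_lt_of_lt hij)
      succ_lt := fun i j heq hij => (hr _ _).2 (altKey_succ_lt heq ((hr i j).1 hij)) }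
  exact ⟨r, hrank, fun r' hr' => eq_of_lt_imp_lt hr'.eq_iff hrank.eq_iff
    fun i j hij => hr'.lt_of_altKey_lt ((hr i j).1 hij)⟩

/-- The alternating key of a suffix, with ties broken by the parity of `i + c`. -/
def tieKey {k : ℕ} (w : ℕ → Fin k) (c i : ℕ) : Lex (ℕ → Fin k) ×ₗ ℕ :=
  toLex (altKey w i, (i + c) % 2)

lemma tieKey_lt_iff {k : ℕ} {w : ℕ → Fin k} {c i j : ℕ} : tieKey w c i < tieKey w c j ↔
    altKey w i < altKey w j ∨ altKey w i = altKey w j ∧ (i + c) % 2 < (j + c) % 2 :=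
  Prod.Lex.toLex_lt_toLex

/-- For the square of a primitive word of odd length `p`, each choice of parity breaks the ties
between the positions `i` and `i + p` consistently. -/
lemma exists_isRanking_tieKey {p k : ℕ} (hp : Odd p) {w : ℕ → Fin k}
    (hw : minimalPeriod shift w = p) (c : ℕ) :
    ∃ r : ℕ → Fin (2 * p), IsRanking w r ∧ ∀ i j, r i < r j ↔ tieKey w c i < tieKey w c j := by
  have hkey : ∀ i j, tieKey w c i = tieKey w c j ↔ i ≡ j [MOD 2 * p] := fun i j => by
    rw [tieKey, tieKey, toLex_inj, Prod.mk.injEq, altKey_eq_iff, suffix_eq_iff (hw ▸ hp.pos), hw,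
      ← Nat.modEq_and_modEq_iff_modEq_mul (Nat.coprime_two_left.2 hp), and_comm]
    exact and_congr_left' ⟨fun h => Nat.ModEq.add_right_cancel' c h, fun h => h.add_right c⟩
  obtain ⟨r, hr⟩ := exists_rank (Nat.mul_pos two_pos hp.pos) hkey
  refine ⟨r, ⟨fun i j => (eq_iff_of_lt_iff hr i j).trans (hkey i j), fun i j hij => ?_,
    fun i j heq hij => ?_⟩, hr⟩
  · exact (hr i j).2 (tieKey_lt_iff.2 (Or.inl (altKey_lt_of_lt hij)))
  · rw [hr, tieKey_lt_iff] at hij ⊢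
    rcases hij with hlt | ⟨he, hpar⟩
    · exact Or.inl (altKey_succ_lt heq hlt)
    · exact Or.inr ⟨(altKey_succ_eq he).symm, by omega⟩

/-- The square of a primitive word of odd length has exactly two rankings. -/
lemma ncard_isRanking_eq_two {p k : ℕ} (hp : Odd p) {w : ℕ → Fin k}
    (hw : minimalPeriod shift w = p) : {r : ℕ → Fin (2 * p) | IsRanking w r}.ncard = 2 := by
  obtain ⟨r₀, h₀, hr₀⟩ := exists_isRanking_tieKey hp hw 0
  obtain ⟨r₁, h₁, hr₁⟩ := exists_isRanking_tieKey hp hw 1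
  have hwp : ∀ t, w (0 + t) = w (p + t) :=
    (suffix_eq_iff (hw ▸ hp.pos)).2 (by rw [hw]; simp [Nat.ModEq])
  have hodd : p % 2 = 1 := Nat.odd_iff.1 hp
  have key : ∀ i j, altKey w i = altKey w j → (i + j) % 2 = 1 → j ≡ p + i [MOD 2 * p] := by
    intro i j hij hpar
    rw [altKey_eq_iff, suffix_eq_iff (hw ▸ hp.pos), hw] at hij
    rw [← Nat.modEq_and_modEq_iff_modEq_mul (Nat.coprime_two_left.2 hp)]
    refine ⟨?_, ?_⟩
    · simp only [Nat.ModEq]; omega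
    · simpa [Nat.ModEq] using hij.symm
  refine Set.ncard_eq_two.2 ⟨r₀, r₁, fun heq => ?_, Set.ext fun r => ⟨fun h => ?_, ?_⟩⟩
  · have hlt : r₀ 0 < r₀ p := (hr₀ _ _).2 (tieKey_lt_iff.2
      (Or.inr ⟨altKey_eq_iff.2 hwp, by omega⟩))
    have hgt : r₁ p < r₁ 0 := (hr₁ _ _).2 (tieKey_lt_iff.2
      (Or.inr ⟨(altKey_eq_iff.2 hwp).symm, by omega⟩))
    rw [heq] at hlt
    exact hlt.not_gt hgt
  · have hne : r 0 ≠ r p := fun he => by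
      have := Nat.le_of_dvd hp.pos ((Nat.modEq_zero_iff_dvd).1 ((h.eq_iff _ _).1 he.symm))
      have := hp.pos
      omega
    -- The comparison of the ranks of `0` and `p` propagates to all pairs `i`, `i + p`.
    rcases lt_or_gt_of_ne hne with hlt | hlt
    · refine Or.inl (eq_of_lt_imp_lt h.eq_iff h₀.eq_iff fun i j hij => ?_)
      rcases tieKey_lt_iff.1 ((hr₀ i j).1 hij) with h' | ⟨he, hpar⟩
      · exact h.lt_of_altKey_lt h'
      · rw [(h.eq_iff _ _).2 (key i j he (by omega))]
        simpa using (h.lt_add hwp hlt i).1 (Nat.even_iff.2 (by omega))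
    · refine Or.inr (eq_of_lt_imp_lt h.eq_iff h₁.eq_iff fun i j hij => ?_)
      rcases tieKey_lt_iff.1 ((hr₁ i j).1 hij) with h' | ⟨he, hpar⟩
      · exact h.lt_of_altKey_lt h'
      · rw [(h.eq_iff _ _).2 (key i j he (by omega))]
        simpa using (h.lt_add (fun t => (hwp t).symm) hlt i).2 (by rw [Nat.even_iff]; omega)
  · rintro (rfl | rfl)
    exacts [h₀, h₁]

/-! ### Labellings compatible with a permutation -/

/-- A labelling `s` of the positions is compatible with `τ` if it is weakly increasing and `τ` is
decreasing on every set of positions with the same label. -/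
def IsCompatible {n k : ℕ} (τ : Perm (Fin n)) (s : Fin n → Fin k) : Prop :=
  ∀ i j, i < j → s i < s j ∨ s i = s j ∧ τ j < τ i

namespace IsCompatible

variable {n k : ℕ} {τ : Perm (Fin n)} {s : Fin n → Fin k}

lemma lt_of_lt (h : IsCompatible τ s) {i j : Fin n} (hij : s i < s j) : i < j := by
  by_contra! hji
  rcases hji.eq_or_lt with rfl | hji
  · exact lt_irrefl _ hij
  · rcases h j i hji with h' | ⟨h', -⟩
    · exact h'.not_gt hij
    · exact hij.ne' h'

lemma apply_lt (h : IsCompatible τ s) {i j : Fin n} (hs : s i = s j) (hij : i < j) :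
    τ j < τ i := by
  rcases h i j hij with h' | ⟨-, h'⟩
  · exact absurd hs h'.ne
  · exact h'

end IsCompatible

/-- The number of positions below `i` that are not ascents of `τ`. -/
def nonAscBelow {n : ℕ} (τ : Perm (Fin n)) (i : ℕ) : ℕ :=
  (Finset.univ.filter fun j : Fin n => (j : ℕ) < i ∧ j ∉ ascSet τ).card

section card

variable {m k : ℕ} (τ : Perm (Fin (m + 1)))

lemma castSucc_mem_ascSet (i : Fin m) : i.castSucc ∈ ascSet τ ↔ τ i.castSucc < τ i.succ := by
  simp only [ascSet, Finset.mem_filter, Finset.mem_univ, true_and]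
  exact ⟨fun ⟨_, h⟩ => h, fun h => ⟨by simp, h⟩⟩

lemma lt_of_mem_ascSet {i : Fin (m + 1)} (hi : i ∈ ascSet τ) : (i : ℕ) < m := by
  obtain ⟨h, -⟩ := (Finset.mem_filter.1 hi).2
  omega

lemma nonAscBelow_zero : nonAscBelow τ 0 = 0 := by simp [nonAscBelow]

lemma nonAscBelow_succ (i : Fin m) :
    nonAscBelow τ (i + 1) = nonAscBelow τ i + if i.castSucc ∈ ascSet τ then 0 else 1 := by
  have hlt : ∀ j : Fin (m + 1), (j : ℕ) < i + 1 ↔ (j : ℕ) < i ∨ j = i.castSucc := fun j => by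
    rw [Fin.ext_iff, Fin.val_castSucc]
    omega
  split_ifs with h
  · refine congrArg Finset.card (Finset.filter_congr fun j _ => ?_)
    rw [hlt]
    constructor
    · rintro ⟨hj | rfl, hj'⟩
      exacts [⟨hj, hj'⟩, absurd h hj']
    · exact fun hj => ⟨Or.inl hj.1, hj.2⟩
  · rw [nonAscBelow, nonAscBelow, ← Finset.card_insert_of_notMem (a := i.castSucc) (by simp)]
    congr 1
    ext j
    simp only [Finset.mem_filter, Finset.mem_univ, true_and, Finset.mem_insert, hlt]
    constructor
    · rintro ⟨hj | hj, hj'⟩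
      exacts [Or.inr ⟨hj, hj'⟩, Or.inl hj]
    · rintro (rfl | hj)
      exacts [⟨Or.inr rfl, h⟩, ⟨Or.inl hj.1, hj.2⟩]

lemma nonAscBelow_mono {i j : ℕ} (h : i ≤ j) : nonAscBelow τ i ≤ nonAscBelow τ j :=
  Finset.card_le_card fun x hx => by
    simp only [Finset.mem_filter, Finset.mem_univ, true_and] at hx ⊢
    exact ⟨hx.1.trans_le h, hx.2⟩

lemma nonAscBelow_last_add_asc : nonAscBelow τ m + asc τ = m := by
  have h := Finset.card_filter_add_card_filter_not (s := Finset.Iio (Fin.last m))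
    (fun j => j ∉ ascSet τ)
  rw [Fin.card_Iio, Fin.val_last] at h
  refine Eq.trans (congrArg₂ (· + ·) (congrArg Finset.card ?_) (congrArg Finset.card ?_)) h
  · ext j
    simp only [Finset.mem_filter, Finset.mem_univ, true_and, Finset.mem_Iio, Fin.lt_def,
      Fin.val_last]
  · ext j
    simp only [Finset.mem_filter, Finset.mem_Iio, not_not]
    exact ⟨fun hj => ⟨lt_of_mem_ascSet τ hj, hj⟩, fun hj => hj.2⟩

/-- Adding to each label the number of earlier non-ascents turns the compatible labellings into the
strictly increasing sequences. -/
lemma isCompatible_iff_strictMono {s : Fin (m + 1) → Fin k} :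
    IsCompatible τ s ↔ StrictMono fun i => (s i : ℕ) + nonAscBelow τ i := by
  have h : IsCompatible τ s ↔ StrictMono fun i => toLex (s i, OrderDual.toDual (τ i)) :=
    by
    simp only [StrictMono, Prod.Lex.toLex_lt_toLex, OrderDual.toDual_lt_toDual, IsCompatible]
  rw [h, Fin.strictMono_iff_lt_succ, Fin.strictMono_iff_lt_succ]
  refine forall_congr' fun i => ?_
  have hne : τ i.castSucc ≠ τ i.succ := fun he =>
    (Fin.castSucc_lt_succ (i := i)).ne (τ.injective he)
  rw [Prod.Lex.toLex_lt_toLex, Fin.val_succ, nonAscBelow_succ, Fin.val_castSucc]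
  simp only [castSucc_mem_ascSet, OrderDual.toDual_lt_toDual, Fin.lt_def, Fin.ext_iff] at hne ⊢
  split_ifs <;> omega

/-- The compatible labellings of `τ` as strictly increasing sequences. -/
def compatibleEquiv :
    {s : Fin (m + 1) → Fin k // IsCompatible τ s} ≃ (Fin (m + 1) ↪o Fin (k + nonAscBelow τ m)) where
  toFun s := OrderEmbedding.ofStrictMono
    (fun i => ⟨s.1 i + nonAscBelow τ i,
      add_lt_add_of_lt_of_le (s.1 i).2 (nonAscBelow_mono τ (Nat.le_of_lt_succ i.2))⟩)
    fun i j hij => (isCompatible_iff_strictMono τ).1 s.2 hij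
  invFun t := by
    have hstep : ∀ i : Fin m, (t i.castSucc : ℕ) < t i.succ := fun i =>
      t.strictMono Fin.castSucc_lt_succ
    have hle : ∀ i, nonAscBelow τ (i : Fin (m + 1)) ≤ t i := fun i => by
      induction i using Fin.induction with
      | zero => simp [nonAscBelow_zero]
      | succ i ih =>
        have := hstep i
        rw [Fin.val_castSucc] at ih
        rw [Fin.val_succ, nonAscBelow_succ]
        split_ifs <;> omega
    have hmono : Monotone fun i => (t i : ℕ) - nonAscBelow τ (i : Fin (m + 1)) :=
      Fin.monotone_iff_le_succ.2 fun i => by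
        have := hstep i
        rw [Fin.val_succ, nonAscBelow_succ, Fin.val_castSucc]
        split_ifs <;> omega
    refine ⟨fun i => ⟨t i - nonAscBelow τ i, (hmono (Fin.le_last i)).trans_lt ?_⟩,
      (isCompatible_iff_strictMono τ).2 fun i j hij => ?_⟩
    · have h1 := hle (Fin.last m)
      have h2 := (t (Fin.last m)).2
      simp only [Fin.val_last] at h1 ⊢
      omega
    · have h1 := hle i
      have h2 := hle j
      have h3 : (t i : ℕ) < t j := t.strictMono hij
      simp only
      omega
  left_inv s := Subtype.ext (funext fun _ => Fin.ext (Nat.add_sub_cancel _ _))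
  right_inv t := by
    have hstep : ∀ i : Fin m, (t i.castSucc : ℕ) < t i.succ := fun i =>
      t.strictMono Fin.castSucc_lt_succ
    ext i
    refine Nat.sub_add_cancel ?_
    induction i using Fin.induction with
    | zero => simp [nonAscBelow_zero]
    | succ i ih =>
      have := hstep i
      rw [Fin.val_castSucc] at ih
      rw [Fin.val_succ, nonAscBelow_succ]
      split_ifs <;> omega

lemma card_isCompatible :
    Nat.card {s : Fin (m + 1) → Fin k // IsCompatible τ s} =
      (k + m - asc τ).choose (m + 1) := by
  rw [Nat.card_congr (compatibleEquiv τ), Nat.card_congr Set.powersetCard.ofFinEmbEquiv,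
    Set.powersetCard.card, Nat.card_fin]
  have := nonAscBelow_last_add_asc τ
  congr 1
  omega

end card

/-- Cyclic permutations together with a compatible labelling. -/
abbrev LabelledCycle (n k : ℕ) : Type :=
  {p : Perm (Fin n) × (Fin n → Fin k) // p.1 ∈ cyclicPerms n ∧ IsCompatible p.1 p.2}

lemma card_labelledCycle {n : ℕ} (hn : 0 < n) (k : ℕ) :
    Nat.card (LabelledCycle n k) =
      ∑ i ∈ Finset.Icc 1 k, (n + k - i).choose (k - i) * C' n i := by
  classical
  obtain ⟨m, rfl⟩ := Nat.exists_eq_succ_of_ne_zero hn.ne'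
  let e : LabelledCycle (m + 1) k ≃ Σ τ : {τ : Perm (Fin (m + 1)) // τ ∈ cyclicPerms (m + 1)},
      {s : Fin (m + 1) → Fin k // IsCompatible τ.1 s} :=
    { toFun := fun p => ⟨⟨p.1.1, p.2.1⟩, ⟨p.1.2, p.2.2⟩⟩
      invFun := fun q => ⟨(q.1.1, q.2.1), q.1.2, q.2.2⟩
      left_inv := fun _ => rfl
      right_inv := fun _ => rfl }
  have hC : ∀ i, C' (m + 1) i =
      ((Finset.univ.filter fun τ : Perm (Fin (m + 1)) => τ ∈ cyclicPerms (m + 1)).filter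
        fun τ => asc τ + 1 = i).card := fun i => by
    rw [C', Set.ncard_eq_toFinset_card', Finset.filter_filter]
    congr 1
    ext τ
    simp
  rw [Nat.card_congr e, Nat.card_sigma]
  simp only [card_isCompatible]
  rw [← Finset.sum_subtype (Finset.univ.filter fun τ => τ ∈ cyclicPerms (m + 1)) (by simp)
    fun τ : Perm (Fin (m + 1)) => (k + m - asc τ).choose (m + 1),
    ← Finset.sum_filter_of_ne (p := fun τ => asc τ + 1 ∈ Finset.Icc 1 k) (fun τ _ hτ => ?_),
    ← Finset.sum_fiberwise_of_maps_to (t := Finset.Icc 1 k) (g := fun τ => asc τ + 1)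
      (fun τ hτ => (Finset.mem_filter.1 hτ).2)]
  · refine Finset.sum_congr rfl fun i hi => ?_
    have hi' := Finset.mem_Icc.1 hi
    rw [hC, mul_comm, ← smul_eq_mul, ← Finset.sum_const, Finset.filter_filter, Finset.filter_filter,
      Finset.filter_filter]
    refine Finset.sum_congr (Finset.filter_congr fun τ _ => ?_) fun τ hτ => ?_
    · exact ⟨fun h => ⟨h.1, h.2.2⟩, fun h => ⟨h.1, h.2 ▸ hi, h.2⟩⟩
    · have hτ' := (Finset.mem_filter.1 hτ).2.2
      rw [← Nat.choose_symm_of_eq_add (by omega : m.succ + k - i = (m + 1) + (k - i))]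
      congr 1
      omega
  -- Labellings with `k` labels exist only for permutations with fewer than `k` ascents.
  · rw [Finset.mem_Icc]
    by_contra hlt
    exact hτ (Nat.choose_eq_zero_of_lt (by omega))

/-! ### Labelled cycles as ranked words -/

/-- Words together with a ranking. -/
abbrev RankedWord (n k : ℕ) : Type :=
  {q : (ℕ → Fin k) × (ℕ → Fin n) // IsRanking q.1 q.2}

/-- Reading the labels and the positions along a labelled cycle gives a ranked word. -/
lemma isRanking_of_labelledCycle {n k : ℕ} (p : LabelledCycle n k) (x : Fin n) :
    IsRanking (fun i => p.1.2 ((p.1.1 ^ i) x)) fun i => (p.1.1 ^ i) x where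
  eq_iff i j := by
    have h : p.1.1.IsCycleOn ((Finset.univ : Finset (Fin n)) : Set (Fin n)) := by
      rw [Finset.coe_univ]
      exact p.2.1
    simpa using h.pow_apply_eq_pow_apply (Finset.mem_univ x) (m := i) (n := j)
  lt_of_lt i j hij := p.2.2.lt_of_lt hij
  succ_lt i j heq hij := by
    rw [pow_succ', pow_succ', Perm.mul_apply, Perm.mul_apply]
    exact p.2.2.apply_lt heq hij

/-- The ranked word read from a labelled cycle and a starting position. -/
def toRankedWord {n k : ℕ} (q : LabelledCycle n k × Fin n) : RankedWord n k :=
  ⟨(fun i => q.1.1.2 ((q.1.1.1 ^ i) q.2), fun i => (q.1.1.1 ^ i) q.2),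
    isRanking_of_labelledCycle q.1 q.2⟩

lemma toRankedWord_injective {n k : ℕ} : Injective (toRankedWord (n := n) (k := k)) := by
  rintro ⟨p, x⟩ ⟨p', x'⟩ h
  have hw : ∀ i, p.1.2 ((p.1.1 ^ i) x) = p'.1.2 ((p'.1.1 ^ i) x') := fun i =>
    congrFun (congrArg (fun q => q.1.1) h) i
  have hr : ∀ i, (p.1.1 ^ i) x = (p'.1.1 ^ i) x' := fun i =>
    congrFun (congrArg (fun q => q.1.2) h) i
  have hsurj := surjective_of_eq_iff (isRanking_of_labelledCycle p x).eq_iff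
  have hx : x = x' := by simpa using hr 0
  have hs : p.1.2 = p'.1.2 := funext fun a => by
    obtain ⟨i, rfl⟩ := hsurj a
    exact (hw i).trans (congrArg p'.1.2 (hr i).symm)
  have hτ : p.1.1 = p'.1.1 := Equiv.ext fun a => by
    obtain ⟨i, rfl⟩ := hsurj a
    have h1 := hr (i + 1)
    rw [pow_succ', pow_succ', Perm.mul_apply, Perm.mul_apply, ← hr i] at h1
    exact h1
  exact Prod.ext (Subtype.ext (Prod.ext hτ hs)) hx

lemma toRankedWord_surjective {n k : ℕ} : Surjective (toRankedWord (n := n) (k := k)) := by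
  rintro ⟨⟨w, r⟩, h⟩
  change IsRanking w r at h
  obtain ⟨g, hg⟩ := (surjective_of_eq_iff h.eq_iff).hasRightInverse
  have hgr : ∀ i, g (r i) ≡ i [MOD n] := fun i => (h.eq_iff _ _).1 (hg (r i))
  -- The permutation sends the rank of a starting point to the rank of the next one.
  have hinj : Injective fun a => r (g a + 1) := fun a b hab => by
    rw [← hg a, ← hg b]
    exact (h.eq_iff _ _).2 (Nat.ModEq.add_right_cancel' 1 ((h.eq_iff _ _).1 hab))
  let τ : Perm (Fin n) := Equiv.ofBijective _ (Finite.injective_iff_bijective.1 hinj)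
  have hτ : ∀ i, τ (r i) = r (i + 1) := fun i => (h.eq_iff _ _).2 ((hgr i).add_right 1)
  have hpow : ∀ i, (τ ^ i) (r 0) = r i := fun i => by
    induction i with
    | zero => rfl
    | succ i ih => rw [pow_succ', Perm.mul_apply, ih, hτ]
  have hw : ∀ i, w (g (r i)) = w i := fun i => by
    rw [← h.periodic.map_mod_nat, hgr i, h.periodic.map_mod_nat]
  have hcyc : τ ∈ cyclicPerms n := by
    refine ⟨Set.bijOn_univ.2 τ.bijective, fun a _ b _ => ?_⟩
    have hsame : ∀ a, τ.SameCycle (r 0) a := fun a => ⟨g a, by rw [zpow_natCast, hpow, hg]⟩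
    exact (hsame a).symm.trans (hsame b)
  have hcomp : IsCompatible τ fun a => w (g a) := by
    intro a b hab
    rcases lt_trichotomy (w (g a)) (w (g b)) with hlt | heq | hlt
    · exact Or.inl hlt
    · exact Or.inr ⟨heq, h.succ_lt _ _ heq (by rwa [hg, hg])⟩
    · have := h.lt_of_lt _ _ hlt
      rw [hg, hg] at this
      exact absurd hab this.not_gt
  refine ⟨(⟨(τ, fun a => w (g a)), hcyc, hcomp⟩, r 0), Subtype.ext (Prod.ext ?_ (funext hpow))⟩
  funext i
  change w (g ((τ ^ i) (r 0))) = w i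
  rw [hpow, hw]

lemma card_labelledCycle_mul (n k : ℕ) :
    Nat.card (LabelledCycle n k) * n = Nat.card (RankedWord n k) := by
  rw [← Nat.card_congr (Equiv.ofBijective _ ⟨toRankedWord_injective, toRankedWord_surjective⟩),
    Nat.card_prod, Nat.card_fin]

/-- Summing the number of rankings over all words of period `n`. -/
lemma card_rankedWord_eq_sum {n : ℕ} (hn : 0 < n) (k : ℕ) : Nat.card (RankedWord n k) =
    ∑ w ∈ periodicWords k n, {r : ℕ → Fin n | IsRanking w r}.ncard := by
  let e : RankedWord n k ≃ Σ w : {w // w ∈ periodicWords k n}, {r : ℕ → Fin n // IsRanking w.1 r} :=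
    { toFun := fun q => ⟨⟨q.1.1, (mem_periodicWords hn).2
        (minimalPeriod_shift_dvd_iff.2 q.2.periodic)⟩, ⟨q.1.2, q.2⟩⟩
      invFun := fun q => ⟨(q.1.1, q.2.1), q.2.2⟩
      left_inv := fun _ => rfl
      right_inv := fun _ => rfl }
  have hfin : Finite (RankedWord n k) :=
    Finite.of_surjective _ (toRankedWord_surjective (n := n) (k := k))
  have : ∀ w : {w // w ∈ periodicWords k n}, Finite {r : ℕ → Fin n // IsRanking w.1 r} := fun w =>
    Finite.of_injective (fun r => (⟨(w.1, r.1), r.2⟩ : RankedWord n k)) fun r r' hrr =>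
      Subtype.ext (congrArg (fun q : RankedWord n k => q.1.2) hrr)
  rw [Nat.card_congr e, Nat.card_sigma]
  exact (Finset.sum_coe_sort (periodicWords k n)
    fun w => {r : ℕ → Fin n | IsRanking w r}.ncard)

lemma ncard_isRanking_of_minimalPeriod_eq {n k : ℕ} (hn : 0 < n) {w : ℕ → Fin k}
    (hw : minimalPeriod shift w = n) : {r : ℕ → Fin n | IsRanking w r}.ncard = 1 := by
  obtain ⟨r, hr, huniq⟩ := existsUnique_isRanking hn hw
  exact Set.ncard_eq_one.2 ⟨r, Set.ext fun r' => ⟨fun h => huniq r' h, fun h => h ▸ hr⟩⟩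

/-- In odd length, only primitive words have rankings. -/
lemma card_rankedWord_of_odd {n : ℕ} (hn : Odd n) (k : ℕ) :
    Nat.card (RankedWord n k) = primCount k n := by
  rw [card_rankedWord_eq_sum hn.pos, primCount, Finset.card_filter]
  refine Finset.sum_congr rfl fun w _ => ?_
  split_ifs with h
  · exact ncard_isRanking_of_minimalPeriod_eq hn.pos h
  · refine (congrArg Set.ncard (Set.eq_empty_of_forall_notMem fun r hr => ?_)).trans
      (Set.ncard_empty _)
    change IsRanking w r at hr
    rcases hr.minimalPeriod_cases with h' | ⟨-, h'⟩
    · exact h h'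
    · exact Nat.not_even_iff_odd.2 hn (h' ▸ even_two_mul _)

/-- In twice an odd length, squares of primitive words contribute two rankings each. -/
lemma card_rankedWord_two_mul_of_odd {m : ℕ} (hm : Odd m) (k : ℕ) :
    Nat.card (RankedWord (2 * m) k) = primCount k (2 * m) + 2 * primCount k m := by
  have hpos : 0 < 2 * m := Nat.mul_pos two_pos hm.pos
  rw [card_rankedWord_eq_sum hpos, primCount, primCount,
    ← filter_minimalPeriod_eq hpos (Dvd.intro_left 2 rfl), Finset.card_filter, Finset.card_filter,
    Finset.mul_sum, ← Finset.sum_add_distrib]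
  refine Finset.sum_congr rfl fun w _ => ?_
  have := hm.pos
  by_cases h : minimalPeriod shift w = 2 * m
  · rw [if_pos h, if_neg (by omega), ncard_isRanking_of_minimalPeriod_eq hpos h,
      mul_zero, add_zero]
  by_cases h' : minimalPeriod shift w = m
  · rw [if_neg h, if_pos h', ncard_isRanking_eq_two hm h', zero_add, mul_one]
  rw [if_neg h, if_neg h', mul_zero, add_zero]
  refine (congrArg Set.ncard (Set.eq_empty_of_forall_notMem fun r hr => ?_)).trans
      (Set.ncard_empty _)
  change IsRanking w r at hr
  rcases hr.minimalPeriod_cases with h1 | ⟨-, h1⟩ <;> omega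

/-! ### The recurrence for the number of cyclic permutations by ascents -/

lemma sum_C'_eq_L_of_odd {m : ℕ} (hm : Odd m) (k : ℕ) :
    ∑ i ∈ Finset.Icc 1 k, ((m + k - i).choose (k - i) : ℚ) * C' m i = L k m := by
  have h := card_labelledCycle_mul m k
  rw [card_rankedWord_of_odd hm, card_labelledCycle hm.pos] at h
  have hm0 : (m : ℚ) ≠ 0 := by exact_mod_cast hm.pos.ne'
  rw [L_eq_primCount_div k hm.pos, eq_div_iff hm0]
  exact_mod_cast h

lemma sum_C'_eq_L_add_L {m : ℕ} (hm : Odd m) (k : ℕ) :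
    ∑ i ∈ Finset.Icc 1 k, ((2 * m + k - i).choose (k - i) : ℚ) * C' (2 * m) i =
      L k (2 * m) + L k m := by
  have hpos : 0 < 2 * m := Nat.mul_pos two_pos hm.pos
  have h := card_labelledCycle_mul (2 * m) k
  rw [card_rankedWord_two_mul_of_odd hm, card_labelledCycle hpos] at h
  have hm0 : (m : ℚ) ≠ 0 := by exact_mod_cast hm.pos.ne'
  have h' := congrArg (Nat.cast : ℕ → ℚ) h
  push_cast at h'
  rw [L_eq_primCount_div k hpos, L_eq_primCount_div k hm.pos]
  push_cast
  field_simp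
  linarith

/-- The case `k = 1` of the counting identity: a cyclic permutation of odd length at least three
has an ascent. -/
lemma C'_one_of_odd {m : ℕ} (hm : Odd m) (h1 : 1 < m) : C' m 1 = 0 := by
  have h := sum_C'_eq_L_of_odd hm 1
  rw [L_eq_primCount_div 1 hm.pos, primCount_one_eq_zero h1] at h
  simpa using h

lemma C'_one_two_mul_of_odd {m : ℕ} (hm : Odd m) (h1 : 1 < m) : C' (2 * m) 1 = 0 := by
  have h := sum_C'_eq_L_add_L hm 1
  rw [L_eq_primCount_div 1 hm.pos, primCount_one_eq_zero h1,
    L_eq_primCount_div 1 (by omega : 0 < 2 * m), primCount_one_eq_zero (by omega : 1 < 2 * m)] at h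
  simpa using h

lemma L_two_mul_eq_sum {m : ℕ} (hm : Odd m) (h1 : 1 < m) {k : ℕ} (hk : 1 ≤ k) :
    L k (2 * m) = ∑ i ∈ Finset.Icc 2 k,
      (((2 * m + k - i).choose (k - i) : ℚ) * (C' (2 * m) i : ℚ)
        - ((m + k - i).choose (k - i) : ℚ) * (C' m i : ℚ)) := by
  have hn := sum_C'_eq_L_add_L hm k
  have hm' := sum_C'_eq_L_of_odd hm k
  rw [← Finset.add_sum_Ioc_eq_sum_Icc hk] at hn hm'
  rw [C'_one_two_mul_of_odd hm h1] at hn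
  rw [C'_one_of_odd hm h1] at hm'
  rw [Finset.sum_sub_distrib]
  have hI : Finset.Icc 2 k = Finset.Ioc 1 k := by
    ext
    simp [Nat.succ_le_iff]
  rw [hI]
  simp only [Nat.cast_zero, mul_zero, zero_add] at hn hm'
  linarith

end CyclicAscents

theorem mainTheorem11 (n k : ℕ) (hn : 3 ≤ n) (hn4 : n ≡ 2 [MOD 4]) (hk : 3 ≤ k) :
    CyclicAscents.L k n =
        ∑ i ∈ Finset.Icc 2 k,
          (((n + k - i).choose (k - i) : ℚ) * (CyclicAscents.C' n i : ℚ)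
            - ((n / 2 + k - i).choose (k - i) : ℚ) * (CyclicAscents.C' (n / 2) i : ℚ))
    ∧ (CyclicAscents.C' n k : ℚ) =
        CyclicAscents.L k n
          - ∑ i ∈ Finset.Icc 2 (k - 1),
              (((n + k - i).choose (k - i) : ℚ) * (CyclicAscents.C' n i : ℚ)
                - ((n / 2 + k - i).choose (k - i) : ℚ) * (CyclicAscents.C' (n / 2) i : ℚ))
          + (CyclicAscents.C' (n / 2) k : ℚ) := by
  have hmod : n % 4 = 2 := hn4
  obtain ⟨m, rfl⟩ : ∃ m, n = 2 * m := ⟨n / 2, by omega⟩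
  have hm : Odd m := Nat.odd_iff.2 (by omega)
  rw [Nat.mul_div_cancel_left m two_pos]
  have key := CyclicAscents.L_two_mul_eq_sum hm (by omega : 1 < m) (by omega : 1 ≤ k)
  refine ⟨key, ?_⟩
  -- The term `i = k` has both binomial coefficients equal to one.
  obtain ⟨l, rfl⟩ : ∃ l, k = l + 1 := ⟨k - 1, by omega⟩
  rw [key, Finset.sum_Icc_succ_top (by omega : 2 ≤ l + 1)]
  simp
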